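/- Let $n,m,l,r\ge 0$ be integers with $n=ml+r$. Let $\bigwedge^m[n]$ be the set of $m$-element subsets of $[n]=\{1,\dots,n\}$ and let $N=\binom nm$ be its cardinality. Take $l$ families of variables $x^a=(x^a_I)_{I\in\bigwedge^m[n]}$, $1\le a\le l$. For each subset $V\subseteq[n]$ with $ml$ elements put $$f_V(x^1,\dots,x^l)=\sum_{(I_1,\dots,I_l)}\operatorname{sign}(I_1,\dots,I_l)\,x^1_{I_1}\cdots x^l_{I_l}\in\mathbb Z[x^1,\dots,x^l],$$ where the sum ranges over all ordered partitions $V=I_1\sqcup\dots\sqcup I_l$ into $m$-element subsets, and $\operatorname{sign}(I_1,\dots,I_l)$ is $(-1)$ to the number of inversions of the sequence obtained by writing $I_1,\dots,I_l$ one after the other, each in increasing order. Let $F$ be the ideal of $\mathbb Z[x^1,\dots,x^l]$ generated by all these forms $f_V$ and, for a commutative ring $R$ with $1$, let $F_R$ be the ideal of $R[x^1,\dots,x^l]$ generated by the images of the $f_V$. Put $$\overline G_F(R)=\{g\in \mathrm{GL}_N(R)\mid f(gx^1,\dots,gx^l)\in F_R\ \text{ for all } f\in F_R\},$$ where $(gx^a)_I=\sum_J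 g_{I,J}\,x^a_J$. This is a subgroup of $\mathrm{GL}_N(R)$, and a ring homomorphism $R\to S$ induces a group homomorphism $\overline G_F(R)\to\overline G_F(S)$ by applying it to the matrix entries. Then the functor $R\mapsto\overline G_F(R)$ from commutative rings to groups is an affine group scheme over $\mathbb Z$; that is, its underlying set-valued functor is representable by a commutative ring $A$: there are bijections $\operatorname{Hom}(A,R)\cong\overline G_F(R)$, natural in $R$. -/

import Mathlib

open CategoryTheory MvPolynomial

universe u

namespace ExteriorStab

noncomputable section

/-! ### Linear substitutions and stabilizers of ideals -/

section Substitution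

variable {ι : Type} [Fintype ι] [DecidableEq ι] {R : Type u} [CommRing R] {l : ℕ}

/-- The substitution `f(x¹, …, xˡ) ↦ f(g x¹, …, g xˡ)` on polynomials in `l` families of variables
`xᵃ = (xᵃ_I)`, `I ∈ ι`; here `X (a, I)` is the variable `xᵃ_I`. -/
def linSubst (l : ℕ) (g : Matrix ι ι R) :
    MvPolynomial (Fin l × ι) R →ₐ[R] MvPolynomial (Fin l × ι) R :=
  aeval fun p => ∑ J, C (g p.2 J) * X (p.1, J)

theorem linSubst_X (g : Matrix ι ι R) (p : Fin l × ι) :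
    linSubst l g (X p) = ∑ J, C (g p.2 J) * X (p.1, J) := by
  simp [linSubst]

theorem linSubst_one : linSubst l (1 : Matrix ι ι R) = AlgHom.id R _ := by
  apply MvPolynomial.algHom_ext
  intro p
  rw [linSubst_X, Finset.sum_eq_single p.2] <;> simp +contextual [eq_comm]

theorem linSubst_mul (g h : Matrix ι ι R) (f : MvPolynomial (Fin l × ι) R) :
    linSubst l (g * h) f = linSubst l h (linSubst l g f) := by
  suffices H : linSubst l (g * h) = (linSubst l h).comp (linSubst l g) from DFunLike.congr_fun H f
  apply MvPolynomial.algHom_ext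
  intro p
  simp only [AlgHom.comp_apply, linSubst_X, Matrix.mul_apply, map_sum, map_mul, algHom_C,
    algebraMap_eq, Finset.sum_mul, Finset.mul_sum]
  rw [Finset.sum_comm]
  simp [mul_assoc]

theorem totalDegree_linSubst_le (g : Matrix ι ι R) (f : MvPolynomial (Fin l × ι) R) :
    (linSubst l g f).totalDegree ≤ f.totalDegree := by
  have hX : ∀ p : Fin l × ι,
      (∑ J, C (g p.2 J) * X (p.1, J) : MvPolynomial (Fin l × ι) R).IsHomogeneous 1 := fun p =>
    IsHomogeneous.sum _ _ _ fun J _ => by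
      simpa using (isHomogeneous_C (Fin l × ι) (g p.2 J)).mul (isHomogeneous_X R (p.1, J))
  conv_lhs => rw [← sum_homogeneousComponent f, map_sum]
  refine (totalDegree_finsetSum _ _).trans (Finset.sup_le fun i hi => ?_)
  have h := (homogeneousComponent_isHomogeneous i f).aeval
    (fun p : Fin l × ι => ∑ J, C (g p.2 J) * X (p.1, J)) hX
  rw [one_mul] at h
  exact h.totalDegree_le.trans (Nat.lt_succ_iff.mp (Finset.mem_range.mp hi))

theorem map_linSubst {S : Type u} [CommRing S] (φ : R →+* S) (g : Matrix ι ι R)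
    (f : MvPolynomial (Fin l × ι) R) :
    MvPolynomial.map φ (linSubst l g f) = linSubst l (g.map φ) (MvPolynomial.map φ f) := by
  induction f using MvPolynomial.induction_on with
  | C a => simp [linSubst]
  | add p q hp hq => simp [hp, hq]
  | mul_X p i hp => simp [hp, linSubst_X]

theorem linSubst_inv_mem (F : Ideal (MvPolynomial (Fin l × ι) R)) (g : GL ι R)
    (hg : ∀ f ∈ F, linSubst l (g : Matrix ι ι R) f ∈ F) :
    ∀ f ∈ F, linSubst l ((g⁻¹ : GL ι R) : Matrix ι ι R) f ∈ F := by
  intro f hf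
  have hinv : ∀ (h : GL ι R) (p : MvPolynomial (Fin l × ι) R),
      linSubst l (h : Matrix ι ι R) (linSubst l ((h⁻¹ : GL ι R) : Matrix ι ι R) p) = p := by
    intro h p
    rw [← linSubst_mul, ← Units.val_mul, inv_mul_cancel, Units.val_one, linSubst_one]
    rfl
  -- restrict to polynomials of bounded degree, a finite module `P`
  let P : Submodule R (MvPolynomial (Fin l × ι) R) :=
    restrictTotalDegree (Fin l × ι) R f.totalDegree
  have hP : ∀ (h : Matrix ι ι R), ∀ p ∈ P, (linSubst l h).toLinearMap p ∈ P := fun h p hp =>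
    (mem_restrictTotalDegree _ _ _).2
      ((totalDegree_linSubst_le h p).trans ((mem_restrictTotalDegree _ _ _).1 hp))
  let T : P →ₗ[R] P := (linSubst l (g : Matrix ι ι R)).toLinearMap.restrict (hP _)
  let N : Submodule R P := (F.restrictScalars R).comap P.subtype
  have hTN : N ≤ N.comap T := fun x hx => hg _ hx
  -- the endomorphism of `P ⧸ N` induced by `g` is surjective, hence injective
  have hsurj : Function.Surjective (N.mapQ N T hTN) := by
    intro y
    obtain ⟨x, rfl⟩ := N.mkQ_surjective y
    refine ⟨N.mkQ ⟨_, hP ((g⁻¹ : GL ι R) : Matrix ι ι R) x x.2⟩, ?_⟩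
    rw [Submodule.mkQ_apply, Submodule.mapQ_apply, Submodule.mkQ_apply]
    congr 1
    exact Subtype.ext (hinv g x)
  have hinj := OrzechProperty.injective_of_surjective_endomorphism _ hsurj
  let y : P := ⟨_, hP ((g⁻¹ : GL ι R) : Matrix ι ι R) f ((mem_restrictTotalDegree _ _ _).2 le_rfl)⟩
  have hy : N.mkQ y = 0 := by
    apply hinj
    rw [map_zero, Submodule.mkQ_apply, Submodule.mapQ_apply, Submodule.Quotient.mk_eq_zero]
    change linSubst l (g : Matrix ι ι R) (linSubst l ((g⁻¹ : GL ι R) : Matrix ι ι R) f) ∈ F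
    rwa [hinv]
  rw [Submodule.mkQ_apply, Submodule.Quotient.mk_eq_zero] at hy
  exact hy

/-- The stabilizer of an ideal `F` of `R[x¹, …, xˡ]`: the group of all `g ∈ GL(R)` such that
`f(g x¹, …, g xˡ) ∈ F` for every `f ∈ F`. -/
def idealStabilizer (F : Ideal (MvPolynomial (Fin l × ι) R)) : Subgroup (GL ι R) where
  carrier := {g | ∀ f ∈ F, linSubst l (g : Matrix ι ι R) f ∈ F}
  one_mem' := fun f hf => by rw [Units.val_one, linSubst_one]; exact hf
  mul_mem' := fun {g h} hg hh f hf => by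
    rw [Units.val_mul, linSubst_mul]; exact hh _ (hg _ hf)
  inv_mem' := fun {g} hg => linSubst_inv_mem F g hg

theorem mem_idealStabilizer {F : Ideal (MvPolynomial (Fin l × ι) R)} {g : GL ι R} :
    g ∈ idealStabilizer F ↔ ∀ f ∈ F, linSubst l (g : Matrix ι ι R) f ∈ F :=
  Iff.rfl

theorem map_mem_idealStabilizer {S : Type u} [CommRing S] (φ : R →+* S)
    {F : Ideal (MvPolynomial (Fin l × ι) R)} {g : GL ι R} (hg : g ∈ idealStabilizer F) :
    Matrix.GeneralLinearGroup.map φ g ∈ idealStabilizer (F.map (MvPolynomial.map φ)) := by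
  suffices H : F.map (MvPolynomial.map φ) ≤ (F.map (MvPolynomial.map φ)).comap
      (linSubst l ((Matrix.GeneralLinearGroup.map φ g : GL ι S) : Matrix ι ι S)).toRingHom from
    fun f hf => H hf
  rw [Ideal.map_le_iff_le_comap]
  intro f hf
  rw [Ideal.mem_comap, Ideal.mem_comap]
  have h := Ideal.mem_map_of_mem (MvPolynomial.map φ) (hg f hf)
  rw [map_linSubst] at h
  exact h

end Substitution

/-! ### The forms `f_V` and the ideal they generate -/

/-- The index set `⋀ᵐ[n]`: the `m`-element subsets of `[n]`. -/
abbrev Idx (n m : ℕ) : Type := {I : Finset (Fin n) // I.card = m}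

/-- `(I₁, …, I_l)` is an ordered partition of `V` into `m`-element subsets. -/
def IsOrderedPartition {n m l : ℕ} (V : Finset (Fin n)) (I : Fin l → Idx n m) : Prop :=
  (∀ a b, a ≠ b → Disjoint (I a).1 (I b).1) ∧ (Finset.univ.biUnion fun a => (I a).1) = V

instance {n m l : ℕ} (V : Finset (Fin n)) :
    DecidablePred (IsOrderedPartition (m := m) (l := l) V) := fun I => by
  unfold IsOrderedPartition
  infer_instance

/-- The sign of the sequence obtained by writing `I₁, …, I_l` (each in increasing order) one after
the other, for pairwise disjoint `I_a`: the parity of the number of inversions. -/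
def partitionSign {n m l : ℕ} (I : Fin l → Idx n m) : ℤ :=
  ∏ a, ∏ b ∈ Finset.Ioi a, ∏ i ∈ (I a).1, ∏ j ∈ (I b).1, if j < i then -1 else 1

/-- The `l`-linear form
`f_V(x¹, …, xˡ) = ∑ sign(I₁, …, I_l) x¹_{I₁} ⋯ xˡ_{I_l}`,
the sum being over all ordered partitions of `V` into `m`-element subsets. -/
def formV {n : ℕ} (m l : ℕ) (V : Finset (Fin n)) : MvPolynomial (Fin l × Idx n m) ℤ :=
  ∑ I : Fin l → Idx n m with IsOrderedPartition V I, C (partitionSign I) * ∏ a, X (a, I a)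

/-- The ideal `F` of `ℤ[x¹, …, xˡ]` generated by the forms `f_V` for all `ml`-element subsets
`V` of `[n]`. -/
def formIdeal (n m l : ℕ) : Ideal (MvPolynomial (Fin l × Idx n m) ℤ) :=
  Ideal.span {f | ∃ V : Finset (Fin n), V.card = m * l ∧ f = formV m l V}

/-- The ideal of `R[x¹, …, xˡ]` generated by the `f_V`. -/
def formIdealOver (n m l : ℕ) (R : Type u) [CommRing R] :
    Ideal (MvPolynomial (Fin l × Idx n m) R) :=
  (formIdeal n m l).map (MvPolynomial.map (Int.castRingHom R))

theorem formIdealOver_map (n m l : ℕ) {R S : Type u} [CommRing R] [CommRing S] (φ : R →+* S) :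
    (formIdealOver n m l R).map (MvPolynomial.map φ) = formIdealOver n m l S := by
  rw [formIdealOver, formIdealOver, Ideal.map_map]
  congr 1
  ext <;> simp

/-! ### The stabilizer as a group functor -/

/-- The functor `R ↦ Ḡ_F(R)` from commutative rings to groups, where `Ḡ_F(R)` is the group of all
`g ∈ GL_N(R)`, `N = n.choose m`, preserving the ideal generated by the `f_V` over `R`. -/
def stabFunctor (n m l : ℕ) : CommRingCat.{u} ⥤ GrpCat.{u} where
  obj R := GrpCat.of (idealStabilizer (formIdealOver n m l R))
  map {R S} φ := GrpCat.ofHom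
    (((Matrix.GeneralLinearGroup.map φ.hom).comp (Subgroup.subtype _)).codRestrict
      (idealStabilizer (formIdealOver n m l S)) fun g => by
        have h := map_mem_idealStabilizer φ.hom g.2
        rw [formIdealOver_map] at h
        exact h)
  map_id R := by
    ext g : 2
    rfl
  map_comp φ ψ := by
    ext g : 2
    rfl

/-- A functor from commutative rings to groups is an affine group scheme over `ℤ` if its underlying
set-valued functor is represented by a commutative ring. -/
def IsAffineGroupScheme (G : CommRingCat.{u} ⥤ GrpCat.{u}) : Prop :=
  (G ⋙ forget GrpCat.{u}).IsCorepresentable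

end

end ExteriorStab

/-! The stabilizer is the closed subscheme of `GL_N` cut out by finitely many integer polynomials.
Since `g` acts by ring homomorphisms, it suffices to test the generators: each `f_V(gx¹, …, gxˡ)`
must lie in `F_R`. This is a multilinear form of degree `l`, the degree of the generators, so it
lies in `F_R` exactly when it is an `R`-linear combination of the `f_W`. A tuple of subsets
partitions at most one `W`, so the `f_W` have disjoint monomial supports, and their coefficients are
signs. Being such a combination therefore amounts to linear equations with integer coefficients, the
same over every `R` (`coeff_of_mem_formIdealOver`, `multilinearForm_mem_of_isFormCombination`). The
coefficients of `f_V(gx¹, …, gxˡ)` are integer polynomials in the entries of `g`. Imposing the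
equations on a generic matrix, with a second one as its inverse, gives the representing ring. -/

namespace ExteriorStab

noncomputable section

/-! ### Multilinear forms in the ideal `F_R` -/

section Multilinear

variable {n m l : ℕ} {R : Type u} [CommRing R]

/-- The exponent of the monomial `x¹_{I₁} ⋯ xˡ_{I_l}`. -/
def multiExp (I : Fin l → Idx n m) : Fin l × Idx n m →₀ ℕ :=
  ∑ a, Finsupp.single (a, I a) 1

theorem multiExp_apply (I : Fin l → Idx n m) (a : Fin l) (J : Idx n m) :
    multiExp I (a, J) = if I a = J then 1 else 0 := by
  classical
  rw [multiExp, Finsupp.finsetSum_apply, Finset.sum_eq_single a]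
  · simp [Finsupp.single_apply]
  · intro b _ hb
    simp [hb]
  · simp

theorem multiExp_injective : Function.Injective (multiExp : (Fin l → Idx n m) → _) := by
  intro I J h
  funext a
  have h1 := DFunLike.congr_fun h (a, J a)
  rw [multiExp_apply, multiExp_apply] at h1
  by_contra hne
  simp [hne] at h1

theorem degree_multiExp (I : Fin l → Idx n m) : (multiExp I).degree = l := by
  simp [multiExp]

theorem prod_X_eq_monomial (I : Fin l → Idx n m) :
    (∏ a, X (a, I a) : MvPolynomial (Fin l × Idx n m) R) = monomial (multiExp I) 1 := by
  rw [multiExp, monomial_sum_one]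
  rfl

/-- The multilinear form `∑ c_J x¹_{J₁} ⋯ xˡ_{J_l}`. -/
def multilinearForm (c : (Fin l → Idx n m) → R) : MvPolynomial (Fin l × Idx n m) R :=
  ∑ J, monomial (multiExp J) (c J)

theorem coeff_multilinearForm (c : (Fin l → Idx n m) → R) (I : Fin l → Idx n m) :
    coeff (multiExp I) (multilinearForm c) = c I := by
  classical
  simp [multilinearForm, coeff_sum, coeff_monomial, multiExp_injective.eq_iff]

theorem coeff_multilinearForm_of_degree_lt (c : (Fin l → Idx n m) → R)
    {d : Fin l × Idx n m →₀ ℕ} (hd : d.degree < l) : coeff d (multilinearForm c) = 0 := by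
  classical
  rw [multilinearForm, coeff_sum]
  refine Finset.sum_eq_zero fun J _ => ?_
  rw [coeff_monomial, if_neg]
  rintro rfl
  exact hd.ne (degree_multiExp J)

theorem map_formV (V : Finset (Fin n)) :
    MvPolynomial.map (Int.castRingHom R) (formV m l V) =
      multilinearForm fun I => if IsOrderedPartition V I then (partitionSign I : R) else 0 := by
  rw [formV, map_sum, multilinearForm, Finset.sum_filter]
  refine Finset.sum_congr rfl fun I _ => ?_
  split_ifs
  · rw [prod_X_eq_monomial, C_mul_monomial, map_monomial]
    simp
  · simp

theorem formIdealOver_eq_span (n m l : ℕ) (R : Type u) [CommRing R] :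
    formIdealOver n m l R = Ideal.span {f | ∃ V : Finset (Fin n), V.card = m * l ∧
      f = MvPolynomial.map (Int.castRingHom R) (formV m l V)} := by
  rw [formIdealOver, formIdeal, Ideal.map_span]
  congr 1
  ext f
  constructor
  · rintro ⟨_, ⟨V, hV, rfl⟩, rfl⟩
    exact ⟨V, hV, rfl⟩
  · rintro ⟨V, hV, rfl⟩
    exact ⟨_, ⟨V, hV, rfl⟩, rfl⟩

theorem map_formV_mem {V : Finset (Fin n)} (hV : V.card = m * l) :
    MvPolynomial.map (Int.castRingHom R) (formV m l V) ∈ formIdealOver n m l R := by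
  rw [formIdealOver_eq_span]
  exact Ideal.subset_span ⟨V, hV, rfl⟩

theorem partitionSign_mul_self (I : Fin l → Idx n m) : partitionSign I * partitionSign I = 1 := by
  simp only [partitionSign, ← Finset.prod_mul_distrib]
  refine Finset.prod_eq_one fun a _ => Finset.prod_eq_one fun b _ => Finset.prod_eq_one fun i _ =>
    Finset.prod_eq_one fun j _ => ?_
  split_ifs <;> rfl

theorem IsOrderedPartition.card_eq {V : Finset (Fin n)} {I : Fin l → Idx n m}
    (h : IsOrderedPartition V I) : V.card = m * l := by
  rw [← h.2, Finset.card_biUnion fun a _ b _ hab => h.1 a b hab,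
    Finset.sum_congr rfl fun a _ => (I a).2]
  simp [mul_comm]

/-- The linear equations on the coefficients of a multilinear form which characterize the linear
combinations of the `f_V`. -/
def IsFormCombination (c : (Fin l → Idx n m) → R) : Prop :=
  (∀ I, (∀ V, ¬ IsOrderedPartition V I) → c I = 0) ∧
    ∀ V I J, IsOrderedPartition V I → IsOrderedPartition V J →
      (partitionSign I : R) * c I = (partitionSign J : R) * c J

/-- When `f` has no terms below degree `l`, only the constant term of `p` contributes in degree `l`.
Multiplication by a polynomial thus acts there as multiplication by a scalar. -/
theorem coeff_multiExp_mul {f : MvPolynomial (Fin l × Idx n m) R}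
    (hf : ∀ d : Fin l × Idx n m →₀ ℕ, d.degree < l → coeff d f = 0)
    (p : MvPolynomial (Fin l × Idx n m) R) (I : Fin l → Idx n m) :
    coeff (multiExp I) (p * f) = coeff 0 p * coeff (multiExp I) f := by
  classical
  rw [coeff_mul, Finset.sum_eq_single (0, multiExp I)]
  · rintro ⟨d, e⟩ h hne
    rw [Finset.HasAntidiagonal.mem_antidiagonal] at h
    dsimp only at h ⊢
    have hdeg : d.degree + e.degree = l := by rw [← map_add, h, degree_multiExp]
    -- A nonconstant factor `d` leaves degree less than `l` for `e`, where `f` vanishes.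
    have hd : d.degree ≠ 0 := by
      intro h0
      rw [Finsupp.degree_eq_zero_iff] at h0
      subst h0
      rw [zero_add] at h
      exact hne (by rw [h])
    rw [hf e (by omega), mul_zero]
  · intro h
    simp at h

/-- The conditions are linear in the coefficients and hold for the generators. The vanishing below
degree `l` is carried along because multiplication by a polynomial needs it, through
`coeff_multiExp_mul`. -/
theorem coeff_of_mem_formIdealOver {f : MvPolynomial (Fin l × Idx n m) R}
    (hf : f ∈ formIdealOver n m l R) :
    (∀ d : Fin l × Idx n m →₀ ℕ, d.degree < l → coeff d f = 0) ∧
      IsFormCombination fun I => coeff (multiExp I) f := by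
  rw [formIdealOver_eq_span] at hf
  induction hf using Submodule.span_induction with
  | mem f h =>
    obtain ⟨V, -, rfl⟩ := h
    rw [map_formV]
    refine ⟨fun d => coeff_multilinearForm_of_degree_lt _, ?_⟩
    simp only [coeff_multilinearForm]
    refine ⟨fun I hI => if_neg (hI V), fun W I J hI hJ => ?_⟩
    -- A tuple partitions only its own union, so `I` and `J` both occur in `f_V` or both do not.
    have hIV : IsOrderedPartition V I ↔ W = V :=
      ⟨fun h => hI.2.symm.trans h.2, fun h => h ▸ hI⟩
    have hJV : IsOrderedPartition V J ↔ W = V :=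
      ⟨fun h => hJ.2.symm.trans h.2, fun h => h ▸ hJ⟩
    simp only [hIV, hJV]
    split_ifs
    · rw [← Int.cast_mul, ← Int.cast_mul, partitionSign_mul_self, partitionSign_mul_self]
    · simp
  | zero => simp [IsFormCombination]
  | add f g _ _ hf hg =>
    refine ⟨fun d hd => by rw [coeff_add, hf.1 d hd, hg.1 d hd, add_zero], fun I hI => ?_,
      fun V I J hI hJ => ?_⟩
    · have hfI := hf.2.1 I hI
      have hgI := hg.2.1 I hI
      dsimp only at hfI hgI ⊢
      rw [coeff_add, hfI, hgI, add_zero]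
    · have hfIJ := hf.2.2 V I J hI hJ
      have hgIJ := hg.2.2 V I J hI hJ
      dsimp only at hfIJ hgIJ ⊢
      rw [coeff_add, coeff_add, mul_add, mul_add, hfIJ, hgIJ]
  | smul p f _ hf =>
    simp only [smul_eq_mul, coeff_multiExp_mul hf.1]
    refine ⟨fun d hd => ?_, fun I hI => ?_, fun V I J hI hJ => ?_⟩
    · classical
      rw [coeff_mul]
      refine Finset.sum_eq_zero fun x hx => ?_
      rw [Finset.HasAntidiagonal.mem_antidiagonal] at hx
      rw [← hx, map_add] at hd
      rw [hf.1 _ (by omega), mul_zero]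
    · have hfI := hf.2.1 I hI
      dsimp only at hfI ⊢
      rw [hfI, mul_zero]
    · have hfIJ := hf.2.2 V I J hI hJ
      dsimp only at hfIJ ⊢
      rw [mul_left_comm, hfIJ, mul_left_comm]

/-- The equations make `c` a constant multiple `d V` of the sign on the partitions of each `V`.
Disjointness of the supports lets these multiples be chosen independently. -/
theorem multilinearForm_mem_of_isFormCombination {c : (Fin l → Idx n m) → R}
    (hc : IsFormCombination c) : multilinearForm c ∈ formIdealOver n m l R := by
  classical
  have hd : ∀ V : Finset (Fin n), ∃ d : R, ∀ I : Fin l → Idx n m, IsOrderedPartition V I →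
      c I = d * (partitionSign I : R) := by
    intro V
    by_cases h : ∃ J : Fin l → Idx n m, IsOrderedPartition V J
    · obtain ⟨J, hJ⟩ := h
      -- Signs are their own inverses, so any one partition `J` of `V` determines the scalar without
      -- division.
      refine ⟨(partitionSign J : R) * c J, fun I hI => ?_⟩
      rw [← hc.2 V I J hI hJ, mul_right_comm, ← Int.cast_mul, partitionSign_mul_self, Int.cast_one,
        one_mul]
    · exact ⟨0, fun I hI => (h ⟨I, hI⟩).elim⟩
  choose d hd using hd
  have key : multilinearForm c = ∑ V : Finset (Fin n) with V.card = m * l,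
      C (d V) * MvPolynomial.map (Int.castRingHom R) (formV m l V) := by
    simp only [map_formV, multilinearForm, Finset.mul_sum, C_mul_monomial]
    rw [Finset.sum_comm]
    refine Finset.sum_congr rfl fun I _ => ?_
    by_cases h : ∃ V, IsOrderedPartition V I
    · obtain ⟨V, hV⟩ := h
      rw [Finset.sum_eq_single V, if_pos hV, hd V I hV]
      · intro W _ hW
        rw [if_neg fun h => hW (h.2.symm.trans hV.2), mul_zero, monomial_zero]
      · intro h
        exact (h (by simpa using hV.card_eq)).elim
    · rw [hc.1 I fun V hV => h ⟨V, hV⟩, monomial_zero]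
      refine (Finset.sum_eq_zero fun V _ => ?_).symm
      rw [if_neg fun hV => h ⟨V, hV⟩, mul_zero, monomial_zero]
  rw [key]
  exact Ideal.sum_mem _ fun V hV =>
    Ideal.mul_mem_left _ _ (map_formV_mem (Finset.mem_filter.mp hV).2)

/-! ### Linear substitutions and the equations of the stabilizer -/

theorem linSubst_multilinearForm (g : Matrix (Idx n m) (Idx n m) R)
    (c : (Fin l → Idx n m) → R) :
    linSubst l g (multilinearForm c) =
      multilinearForm fun J => ∑ I, c I * ∏ a, g (I a) (J a) := by
  simp only [multilinearForm, map_sum]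
  rw [Finset.sum_comm]
  refine Finset.sum_congr rfl fun I _ => ?_
  rw [← mul_one (c I), ← C_mul_monomial, ← prod_X_eq_monomial, map_mul, algHom_C, map_prod]
  simp only [linSubst_X]
  -- The product of `l` sums expands into a sum over all tuples `J`.
  rw [Finset.prod_univ_sum, Finset.mul_sum, Fintype.piFinset_univ]
  refine Finset.sum_congr rfl fun J _ => ?_
  rw [Finset.prod_mul_distrib, prod_X_eq_monomial, ← map_prod, C_mul_monomial, algebraMap_eq,
    C_mul_monomial]
  simp

/-- The coefficient of `x¹_{J₁} ⋯ xˡ_{J_l}` in `f_V(g x¹, …, g xˡ)`. -/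
def substCoeff (l : ℕ) (g : Matrix (Idx n m) (Idx n m) R) (V : Finset (Fin n))
    (J : Fin l → Idx n m) : R :=
  ∑ I : Fin l → Idx n m with IsOrderedPartition V I,
    (partitionSign I : R) * ∏ a, g (I a) (J a)

theorem linSubst_map_formV (g : Matrix (Idx n m) (Idx n m) R) (V : Finset (Fin n)) :
    linSubst l g (MvPolynomial.map (Int.castRingHom R) (formV m l V)) =
      multilinearForm (substCoeff l g V) := by
  rw [map_formV, linSubst_multilinearForm]
  congr 1
  funext J
  rw [substCoeff, Finset.sum_filter]
  simp only [ite_mul, zero_mul]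

/-- This allows the equations to be written once for the generic matrix and then specialized to any
ring. -/
theorem map_substCoeff {S : Type*} [CommRing S] (φ : R →+* S)
    (g : Matrix (Idx n m) (Idx n m) R) (V : Finset (Fin n)) (J : Fin l → Idx n m) :
    φ (substCoeff l g V J) = substCoeff l (g.map φ) V J := by
  simp [substCoeff]

/-- Preservation of the ideal is checked on generators, which turns it into finitely many polynomial
equations in the entries of `g`. -/
theorem mem_idealStabilizer_formIdealOver_iff {g : GL (Idx n m) R} :
    g ∈ idealStabilizer (formIdealOver n m l R) ↔
      ∀ V : Finset (Fin n), V.card = m * l →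
        IsFormCombination (substCoeff l (g : Matrix (Idx n m) (Idx n m) R) V) := by
  rw [mem_idealStabilizer]
  constructor
  · intro h V hV
    have h1 := (coeff_of_mem_formIdealOver (h _ (map_formV_mem hV))).2
    simpa only [linSubst_map_formV, coeff_multilinearForm] using h1
  · intro h
    suffices H : formIdealOver n m l R ≤ (formIdealOver n m l R).comap
        (linSubst l (g : Matrix (Idx n m) (Idx n m) R)).toRingHom from fun f hf => H hf
    nth_rewrite 1 [formIdealOver_eq_span]
    rw [Ideal.span_le]
    rintro _ ⟨V, hV, rfl⟩
    change linSubst l (g : Matrix (Idx n m) (Idx n m) R) _ ∈ formIdealOver n m l R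
    rw [linSubst_map_formV]
    exact multilinearForm_mem_of_isFormCombination (h V hV)

end Multilinear

/-! ### The representing ring -/

section CoordinateRing

variable (n m l : ℕ)

/-- The polynomial ring in the entries of two square matrices of size `n.choose m`. -/
abbrev MatrixPairRing (n m : ℕ) : Type u :=
  MvPolynomial (ULift.{u} (Bool × Idx n m × Idx n m)) ℤ

/-- The two generic matrices. -/
def genericMatrix (b : Bool) : Matrix (Idx n m) (Idx n m) (MatrixPairRing.{u} n m) :=
  fun I J => X ⟨(b, I, J)⟩

/-- The equations saying that the two matrices are inverse to each other and that the first one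
preserves the span of the forms `f_V`. -/
inductive IsStabEquation : MatrixPairRing.{u} n m → Prop
  | mul (b : Bool) (I J : Idx n m) :
      IsStabEquation ((genericMatrix n m b * genericMatrix n m !b) I J -
        (1 : Matrix (Idx n m) (Idx n m) (MatrixPairRing n m)) I J)
  | vanish (V : Finset (Fin n)) (hV : V.card = m * l) (I : Fin l → Idx n m)
      (hI : ∀ W, ¬ IsOrderedPartition W I) :
      IsStabEquation (substCoeff l (genericMatrix n m true) V I)
  | proportional (V : Finset (Fin n)) (hV : V.card = m * l) (W : Finset (Fin n))
      (I J : Fin l → Idx n m) (hI : IsOrderedPartition W I) (hJ : IsOrderedPartition W J) :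
      IsStabEquation ((partitionSign I : MatrixPairRing n m) *
          substCoeff l (genericMatrix n m true) V I -
        (partitionSign J : MatrixPairRing n m) * substCoeff l (genericMatrix n m true) V J)

/-- The ideal of the equations defining the stabilizer. -/
def stabEquations : Ideal (MatrixPairRing.{u} n m) :=
  Ideal.span {p | IsStabEquation n m l p}

variable {R : Type u} [CommRing R]

theorem stabEquations_le_ker_iff (φ : MatrixPairRing.{u} n m →+* R) :
    stabEquations n m l ≤ RingHom.ker φ ↔
      (∀ b, (genericMatrix n m b).map φ * (genericMatrix n m !b).map φ = 1) ∧
      ∀ V : Finset (Fin n), V.card = m * l →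
        IsFormCombination (substCoeff l ((genericMatrix n m true).map φ) V) := by
  have hmul : ∀ b I J, φ ((genericMatrix n m b * genericMatrix n m !b) I J -
        (1 : Matrix (Idx n m) (Idx n m) (MatrixPairRing n m)) I J) =
      ((genericMatrix n m b).map φ * (genericMatrix n m !b).map φ) I J -
        (1 : Matrix (Idx n m) (Idx n m) R) I J := by
    intro b I J
    rw [map_sub, ← Matrix.map_mul, Matrix.map_apply, Matrix.one_apply, Matrix.one_apply]
    split_ifs <;> simp
  rw [stabEquations, Ideal.span_le]
  constructor
  · intro h
    refine ⟨fun b => ?_, fun V hV => ⟨fun I hI => ?_, fun W I J hI hJ => ?_⟩⟩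
    · ext I J
      rw [← sub_eq_zero, ← hmul]
      exact h (.mul b I J)
    · rw [← map_substCoeff]
      exact h (.vanish V hV I hI)
    · have h1 : φ _ = 0 := h (.proportional V hV W I J hI hJ)
      rw [map_sub, map_mul, map_mul, map_intCast, map_intCast, map_substCoeff,
        map_substCoeff] at h1
      exact sub_eq_zero.mp h1
  · rintro ⟨h1, h2⟩ p hp
    change φ p = 0
    cases hp with
    | mul b I J => rw [hmul, h1, sub_self]
    | vanish V hV I hI =>
      rw [map_substCoeff]
      exact (h2 V hV).1 I hI
    | proportional V hV W I J hI hJ =>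
      rw [map_sub, map_mul, map_mul, map_intCast, map_intCast, map_substCoeff, map_substCoeff,
        (h2 V hV).2 W I J hI hJ, sub_self]

/-- The point of the stabilizer given by a solution of the defining equations. -/
def stabPoint (φ : MatrixPairRing.{u} n m →+* R) (h : stabEquations n m l ≤ RingHom.ker φ) :
    idealStabilizer (formIdealOver n m l R) :=
  ⟨⟨(genericMatrix n m true).map φ, (genericMatrix n m false).map φ,
    ((stabEquations_le_ker_iff n m l φ).1 h).1 true,
    ((stabEquations_le_ker_iff n m l φ).1 h).1 false⟩,
    mem_idealStabilizer_formIdealOver_iff.2 ((stabEquations_le_ker_iff n m l φ).1 h).2⟩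

/-- The unit records both the matrix and its inverse, hence the values of `φ` on all variables. -/
theorem stabPoint_injective {φ ψ : MatrixPairRing.{u} n m →+* R}
    {hφ : stabEquations n m l ≤ RingHom.ker φ} {hψ : stabEquations n m l ≤ RingHom.ker ψ}
    (h : stabPoint n m l φ hφ = stabPoint n m l ψ hψ) : φ = ψ := by
  have h0 : (stabPoint n m l φ hφ).1 = (stabPoint n m l ψ hψ).1 := congrArg Subtype.val h
  have h1 : (genericMatrix n m true).map φ = (genericMatrix n m true).map ψ :=
    congrArg Units.val h0
  have h2 : (genericMatrix n m false).map φ = (genericMatrix n m false).map ψ :=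
    congrArg Units.inv h0
  refine MvPolynomial.ringHom_ext (fun a => by simp) ?_
  rintro ⟨b, I, J⟩
  cases b
  · exact congrFun (congrFun h2 I) J
  · exact congrFun (congrFun h1 I) J

theorem exists_stabPoint_eq (g : idealStabilizer (formIdealOver n m l R)) :
    ∃ (φ : MatrixPairRing.{u} n m →+* R) (h : stabEquations n m l ≤ RingHom.ker φ),
      stabPoint n m l φ h = g := by
  let G : Bool → Matrix (Idx n m) (Idx n m) R := fun b => cond b g.1.val g.1.inv
  let φ : MatrixPairRing.{u} n m →+* R :=
    eval₂Hom (Int.castRingHom R) fun x => G x.down.1 x.down.2.1 x.down.2.2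
  have hG : ∀ b, (genericMatrix n m b).map φ = G b := by
    intro b
    ext I J
    simp [genericMatrix, φ]
  have h : stabEquations n m l ≤ RingHom.ker φ := by
    rw [stabEquations_le_ker_iff]
    simp only [hG]
    refine ⟨?_, mem_idealStabilizer_formIdealOver_iff.1 g.2⟩
    rintro (_ | _)
    · exact g.1.inv_val
    · exact g.1.val_inv
  exact ⟨φ, h, Subtype.ext (Units.ext (hG true))⟩

/-- The coordinate ring of the stabilizer. -/
abbrev StabRing (n m l : ℕ) : Type u :=
  MatrixPairRing.{u} n m ⧸ stabEquations.{u} n m l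

theorem stabEquations_le_ker_comp_mk (φ : StabRing.{u} n m l →+* R) :
    stabEquations n m l ≤ RingHom.ker (φ.comp (Ideal.Quotient.mk (stabEquations n m l))) := by
  intro p hp
  rw [RingHom.mem_ker, RingHom.comp_apply, Ideal.Quotient.eq_zero_iff_mem.2 hp, map_zero]

/-- Homomorphisms from the coordinate ring to `R` are the points of the stabilizer over `R`. -/
def stabRingHomEquiv (R : Type u) [CommRing R] :
    (StabRing.{u} n m l →+* R) ≃ idealStabilizer (formIdealOver n m l R) :=
  Equiv.ofBijective
    (fun φ => stabPoint n m l _ (stabEquations_le_ker_comp_mk n m l φ))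
    ⟨fun _ _ h => Ideal.Quotient.ringHom_ext (stabPoint_injective n m l h), fun g => by
      obtain ⟨φ, h, rfl⟩ := exists_stabPoint_eq n m l g
      exact ⟨Ideal.Quotient.lift _ φ fun p hp => h hp, rfl⟩⟩

/-- The coordinate ring corepresents the stabilizer. -/
def stabFunctorCorepresentableBy :
    (stabFunctor.{u} n m l ⋙ forget GrpCat.{u}).CorepresentableBy
      (CommRingCat.of (StabRing.{u} n m l)) where
  homEquiv {R} := ConcreteCategory.homEquiv.trans (stabRingHomEquiv n m l R)
  -- Naturality is definitional: the point is the generic matrix with the homomorphism applied to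
  -- its entries.
  homEquiv_comp _ _ := rfl

end CoordinateRing

end

end ExteriorStab

theorem mainTheorem10 (n m l r : ℕ) (hn : n = m * l + r) :
    ExteriorStab.IsAffineGroupScheme (ExteriorStab.stabFunctor.{u} n m l) :=
  (ExteriorStab.stabFunctorCorepresentableBy n m l).isCorepresentable
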